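/- **Model.** Let $V$ be a finite set, $f:2^V\to\mathbb R$ a nonnegative monotone submodular function, and $\mathcal M$ a matroid on $V$ of rank $k$. An insertion-only stream is a finite sequence $e_1,e_2,\dots,e_n$ of elements of $V$; put $V_i=\{e_1,\dots,e_i\}$ and $\mathrm{OPT}_i=\max\{f(T): T\subseteq V_i,\ T\in\mathcal M\}$. A deterministic dynamic algorithm receives $e_i$ at the beginning of round $i$, then makes finitely many adaptive queries, each of which asks for a value $f(S)$ or asks whether $S\in\mathcal M$ (it remembers all earlier insertions and answers), and then outputs a set $S_i$; it also holds a set $S_0$ before the first round, where $V_0=\emptyset$. Queries of both kinds are counted. **Theorem.** There are universal constants $C,c>0$ and $d\in\mathbb N$ such that for every $\varepsilon>0$ and every integer $k\ge 0$ there is a deterministic dynamic algorithm, which is given $\varepsilon$ and $k$ but neither $V$ nor the stream length $n$, with the following properties for every $V$, $f$, $\mathcal M$ as above with $\operatorname{rank}(\mathcal M)=k$ and for every insertion-only stream $e_1,\dots,e_n$ in $V$. 1. For every $0\le i\le n$, the maintained set is a feasible $(1/2-\varepsilon)$-approximate solution: $S_i\subseteq V_i$, $S_i\in\mathcal M$ and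 $f(S_i)\ge(1/2-\varepsilon)\,\mathrm{OPT}_i$. 2. The amortized query complexity is $k^{\tilde O(1/\varepsilon)}$ at the end of every round: for every $0\le i\le n$, the total number of queries to $f$ and $\mathcal M$ made in rounds $1,\dots,i$ is at most $i\cdot C\,k^{\,c\,\frac1\varepsilon\,\log^{d}(2+1/\varepsilon)}$. 3. In round $i$ only subsets of $V_i$ are queried. -/

import Mathlib

universe u v

namespace DynamicSubmodular

/-- A deterministic adaptive computation returning a value of type `β`, with two oracles on finite
sets of elements of `α`: `value S next` asks for the real number `f S` and continues with
`next (f S)`; `indep S yes no` asks whether `S` is independent and continues accordingly. -/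
inductive QueryProgram (α : Type u) (β : Type v) : Type (max u v) where
  | done (b : β) : QueryProgram α β
  | value (S : Finset α) (next : ℝ → QueryProgram α β) : QueryProgram α β
  | indep (S : Finset α) (yes no : QueryProgram α β) : QueryProgram α β

namespace QueryProgram

variable {α : Type u} {β : Type v}

open Classical in
/-- The value returned when the oracles are `f` and the matroid `M`. -/
noncomputable def result (f : Finset α → ℝ) (M : Matroid α) : QueryProgram α β → β
  | done b => b
  | value S next => (next (f S)).result f M
  | indep S yes no => if M.Indep (S : Set α) then yes.result f M else no.result f M

open Classical in
/-- The list of all queried sets (for both oracles, with repetitions) when the oracles are `f` and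
the matroid `M`. -/
noncomputable def queries (f : Finset α → ℝ) (M : Matroid α) :
    QueryProgram α β → List (Finset α)
  | done _ => []
  | value S next => S :: (next (f S)).queries f M
  | indep S yes no => S :: (if M.Indep (S : Set α) then yes.queries f M else no.queries f M)

end QueryProgram

/-- A deterministic dynamic algorithm for insertion-only streams of elements of `α`. Its memory is
an arbitrary state; at an insertion it makes adaptive oracle queries to compute the new state. At
the end of every round the maintained solution is read off the state. It gets no information on
the function, the matroid, the ground set or the length of the stream except through
the insertions and the oracle answers. -/
structure DynamicAlgorithm (α : Type u) where
  State : Type u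
  start : State
  insert : State → α → QueryProgram α State
  output : State → Finset α

namespace DynamicAlgorithm

variable {α : Type u} (A : DynamicAlgorithm α) (f : Finset α → ℝ) (M : Matroid α)

/-- State and total number of queries made (to `f` and to `M`) after processing a stream. -/
noncomputable def run (σ : List α) : A.State × ℕ :=
  σ.foldl
    (fun c e => ((A.insert c.1 e).result f M, c.2 + ((A.insert c.1 e).queries f M).length))
    (A.start, 0)

/-- The solution maintained after processing the stream `σ`. -/
noncomputable def solution (σ : List α) : Finset α := A.output (A.run f M σ).1

/-- The total number of queries made while processing the stream `σ`. -/
noncomputable def queryCount (σ : List α) : ℕ := (A.run f M σ).2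

/-- The sets queried in the round in which `e` is inserted after the stream `σ`. -/
noncomputable def roundQueries (σ : List α) (e : α) : List (Finset α) :=
  (A.insert (A.run f M σ).1 e).queries f M

end DynamicAlgorithm

/-- `f` is a nonnegative, monotone, submodular function on the subsets of `V`. -/
structure IsMonotoneSubmodular {α : Type u} [DecidableEq α] (V : Finset α)
    (f : Finset α → ℝ) : Prop where
  nonneg : ∀ S, S ⊆ V → 0 ≤ f S
  mono : ∀ S T, S ⊆ T → T ⊆ V → f S ≤ f T
  submodular : ∀ S T, S ⊆ V → T ⊆ V → f (S ∪ T) + f (S ∩ T) ≤ f S + f T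

open Classical in
/-- The independent sets of `M` contained in `W`. -/
noncomputable def feasibleSets {α : Type u} (M : Matroid α) (W : Finset α) :
    Finset (Finset α) :=
  W.powerset.filter fun T => M.Indep (T : Set α)

theorem feasibleSets_nonempty {α : Type u} (M : Matroid α) (W : Finset α) :
    (feasibleSets M W).Nonempty :=
  ⟨∅, by simp [feasibleSets]⟩

/-- The optimum value `max {f T : T ⊆ W, T independent in M}`. -/
noncomputable def opt {α : Type u} (f : Finset α → ℝ) (M : Matroid α) (W : Finset α) : ℝ :=
  (feasibleSets M W).sup' (feasibleSets_nonempty M W) f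

/-- `S` is a feasible `γ`-approximate solution of `f` under `M` with respect to `W`. -/
def IsApproxSolution {α : Type u} (γ : ℝ) (f : Finset α → ℝ) (M : Matroid α)
    (W S : Finset α) : Prop :=
  S ⊆ W ∧ M.Indep (S : Set α) ∧ γ * opt f M W ≤ f S

end DynamicSubmodular

/-! The algorithm is local search on the gain `f S - f ∅`. If no single swap raises the gain of `S`
by a factor above `1 + δ`, then every feasible `T` has gain at most `2 + kδ` times that of `S`
(`gain_le_of_locally_optimal`): an exchange injection charges each element of `T` to at most one
element of `S`, and the losses from single removals sum to at most the gain of `S`. Taking `kδ = ε`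
gives the ratio.

Local optimality is cheap to maintain because elements become negligible. On arrival, the gain of a
nonloop `{x}` is at most about that of the current solution, and every improving swap multiplies the
latter by more than `1 + δ`. After about `N` improvements the gain of `{x}` is below a `δ` fraction,
and `x` can be forgotten. Rescans happen only after improvements, so `x` takes part in at most `N`
of them besides its first test, at `4(k + 1)` queries each. The sum of the counters is the potential
that makes this hold after every round (`improve_spec`, `insertElement_spec`). With `N = ⌈(k/ε)²⌉`
the cost is polynomial in `k/ε`, which `query_bound` absorbs into a power of `k` when `k ≥ 2`. -/

namespace DynamicSubmodular

/-! ### Matroid exchange -/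

variable {α : Type u} [DecidableEq α]

/-- Every element that cannot be added to the independent set `S` can be assigned an element of `S`
for which it can be exchanged, in such a way that distinct elements of an independent set `T` are
assigned distinct elements. -/
theorem exists_exchange_injection (M : Matroid α) {S T : Finset α}
    (hS : M.Indep (S : Set α)) (hT : M.Indep (T : Set α)) :
    ∃ p : {t // t ∈ T ∧ ¬ M.Indep (insert t S : Finset α)} → α, Function.Injective p ∧
      ∀ t, p t ∈ S ∧ M.Indep (insert t.1 (S.erase (p t)) : Finset α) := by
  classical
  -- Hall's condition: `N t` is the part of the fundamental circuit of `t` lying in `S`, so `X` is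
  -- in the closure of its neighbours; being independent, it is no larger than their union.
  let N : {t // t ∈ T ∧ ¬ M.Indep (insert t S : Finset α)} → Finset α := fun t =>
    S.filter fun y => M.Indep (insert t.1 (S.erase y) : Finset α)
  obtain ⟨p, hp, hpN⟩ := (Finset.all_card_le_biUnion_card_iff_exists_injective N).1 (by
    intro X
    have hcl : ((X.map (Function.Embedding.subtype _) : Finset α) : Set α) ⊆
        M.closure (X.biUnion N : Finset α) := by
      intro t ht
      simp only [Finset.coe_map, Set.mem_image, Finset.mem_coe] at ht
      obtain ⟨t, htX, rfl⟩ := ht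
      have htS : (t : α) ∉ (S : Set α) := by
        intro h
        apply t.2.2
        rwa [Finset.insert_eq_of_mem (by simpa using h)]
      have htE : (t : α) ∈ M.E := hT.subset_ground (by simpa using t.2.1)
      have htcl : (t : α) ∈ M.closure (S : Set α) := by
        by_contra h
        exact t.2.2 (by simpa using (hS.notMem_closure_iff_of_notMem htS htE).1 h)
      have hC := hS.fundCircuit_isCircuit htcl htS
      have hmem := hC.mem_closure_sdiff_singleton_of_mem (M.mem_fundCircuit t S)
      refine M.closure_subset_closure ?_ hmem
      intro y hy
      have hyS : y ∈ S := by
        rcases M.fundCircuit_subset_insert _ _ hy.1 with h | h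
        · exact absurd h hy.2
        · simpa using h
      have hyI := (hS.mem_fundCircuit_iff htcl htS).1 hy.1
      simp only [Finset.coe_biUnion, Set.mem_iUnion, Finset.mem_coe]
      refine ⟨t, htX, Finset.mem_filter.2 ⟨hyS, ?_⟩⟩
      convert hyI using 1
      ext z
      simp only [Finset.coe_insert, Finset.coe_erase, Set.mem_insert_iff, Set.mem_sdiff,
        Set.mem_singleton_iff]
      have : (t : α) ≠ y := fun h => htS (by simpa [h] using hyS)
      grind
    have hX : M.Indep ((X.map (Function.Embedding.subtype _) : Finset α) : Set α) :=
      hT.subset (by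
        intro t ht
        simp only [Finset.coe_map, Set.mem_image, Finset.mem_coe] at ht
        obtain ⟨t, -, rfl⟩ := ht
        exact t.2.1)
    have h1 := hX.encard_le_eRk_of_subset hcl
    rw [M.eRk_closure_eq] at h1
    have h2 := h1.trans (M.eRk_le_encard _)
    rw [Set.encard_coe_eq_coe_finsetCard, Set.encard_coe_eq_coe_finsetCard,
      Finset.card_map] at h2
    exact_mod_cast h2)
  exact ⟨p, hp, fun t => Finset.mem_filter.1 (hpN t)⟩

/-! ### Submodular inequalities -/

namespace IsMonotoneSubmodular

variable {V : Finset α} {f : Finset α → ℝ}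

theorem insert_sub_le (hf : IsMonotoneSubmodular V f) {A B : Finset α} {t : α} (hAB : A ⊆ B)
    (hB : B ⊆ V) (ht : t ∈ V) : f (insert t B) - f B ≤ f (insert t A) - f A := by
  by_cases htB : t ∈ B
  · rw [Finset.insert_eq_of_mem htB]
    have := hf.mono A (insert t A) (Finset.subset_insert _ _)
      (Finset.insert_subset ht (hAB.trans hB))
    linarith
  · have h := hf.submodular (insert t A) B (Finset.insert_subset ht (hAB.trans hB)) hB
    have h1 : insert t A ∪ B = insert t B := by grind
    have h2 : insert t A ∩ B = A := by grind
    rw [h1, h2] at h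
    linarith

theorem union_sub_le_sum (hf : IsMonotoneSubmodular V f) {S : Finset α} (hS : S ⊆ V)
    (T : Finset α) (hT : T ⊆ V) : f (S ∪ T) - f S ≤ ∑ t ∈ T, (f (insert t S) - f S) := by
  induction T using Finset.induction_on with
  | empty => simp
  | insert a T ha ih =>
    have hTV := (Finset.subset_insert _ _).trans hT
    have haV := hT (Finset.mem_insert_self _ _)
    rw [Finset.sum_insert ha, Finset.union_insert]
    have := hf.insert_sub_le (Finset.subset_union_left (s₁ := S) (s₂ := T))
      (Finset.union_subset hS hTV) haV
    linarith [ih hTV]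

/-- Removing the elements of `Y` one by one telescopes, and by submodularity each removal costs at
least as much as removing that element from the full set `S`. -/
theorem sum_sub_erase_le (hf : IsMonotoneSubmodular V f) {S : Finset α} (hS : S ⊆ V)
    (Y : Finset α) (hY : Y ⊆ S) : ∑ y ∈ Y, (f S - f (S.erase y)) ≤ f S - f ∅ := by
  have key : ∑ y ∈ Y, (f S - f (S.erase y)) ≤ f S - f (S \ Y) := by
    induction Y using Finset.induction_on with
    | empty => simp
    | insert a Y ha ih =>
      have haS := hY (Finset.mem_insert_self _ _)
      rw [Finset.sum_insert ha]
      have := hf.insert_sub_le (A := S \ insert a Y) (B := S.erase a) (t := a) (by grind)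
        ((Finset.erase_subset _ _).trans hS) (hS haS)
      rw [Finset.insert_erase haS, show insert a (S \ insert a Y) = S \ Y by grind] at this
      linarith [ih ((Finset.subset_insert _ _).trans hY)]
  linarith [hf.mono ∅ (S \ Y) (Finset.empty_subset _) (Finset.sdiff_subset.trans hS)]

end IsMonotoneSubmodular

/-! ### Swaps and approximate local optima -/

/-- The sets obtained from `S` by adding `x` and removing at most one element. -/
noncomputable def swaps (S : Finset α) (x : α) : List (Finset α) :=
  insert x S :: S.toList.map fun y => insert x (S.erase y)

theorem length_swaps (S : Finset α) (x : α) : (swaps S x).length = S.card + 1 := by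
  simp [swaps]

theorem mem_of_mem_swaps {S T : Finset α} {x : α} (h : T ∈ swaps S x) : x ∈ T := by
  simp only [swaps, List.mem_cons, List.mem_map] at h
  grind

theorem subset_insert_of_mem_swaps {S T : Finset α} {x : α} (h : T ∈ swaps S x) :
    T ⊆ insert x S := by
  simp only [swaps, List.mem_cons, List.mem_map] at h
  grind

theorem insert_mem_swaps (S : Finset α) (x : α) : insert x S ∈ swaps S x := by
  simp [swaps]

theorem insert_erase_mem_swaps {S : Finset α} {y : α} (hy : y ∈ S) (x : α) :
    insert x (S.erase y) ∈ swaps S x := by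
  simp only [swaps, List.mem_cons, List.mem_map, Finset.mem_toList]
  exact Or.inr ⟨y, hy, rfl⟩

/-- Used for an arriving nonloop with no improving swap: some feasible swap contains it, so its own
gain is at most `1 + δ` times that of `S`. -/
theorem exists_indep_mem_swaps {M : Matroid α} {S : Finset α} (hS : M.Indep (S : Set α)) {x : α}
    (hx : M.Indep {x}) : ∃ T ∈ swaps S x, M.Indep (T : Set α) := by
  by_cases h : M.Indep (insert x S : Finset α)
  · exact ⟨_, insert_mem_swaps S x, h⟩
  · obtain ⟨p, -, hp⟩ := exists_exchange_injection M hS (T := {x}) (by simpa using hx)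
    have := hp ⟨x, by simp, h⟩
    exact ⟨_, insert_erase_mem_swaps this.1 x, this.2⟩

/-- `T` is independent and its gain over `∅` exceeds the one of `S` by a factor of more than
`1 + δ`. -/
def Improves (f : Finset α → ℝ) (M : Matroid α) (δ : ℝ) (S T : Finset α) : Prop :=
  M.Indep (T : Set α) ∧ (1 + δ) * (f S - f ∅) < f T - f ∅

theorem gain_le_of_locally_optimal {V : Finset α} {f : Finset α → ℝ} {M : Matroid α}
    (hf : IsMonotoneSubmodular V f) {δ : ℝ} {k : ℕ} (hδ : 0 ≤ δ) {S T : Finset α}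
    (hSV : S ⊆ V) (hTV : T ⊆ V) (hS : M.Indep (S : Set α)) (hT : M.Indep (T : Set α))
    (hk : T.card ≤ k)
    (hopt : ∀ t ∈ T, f {t} - f ∅ ≤ δ * (f S - f ∅) ∨ ∀ R ∈ swaps S t, ¬ Improves f M δ S R) :
    f T - f ∅ ≤ (2 + k * δ) * (f S - f ∅) := by
  classical
  obtain ⟨p, hp, hpS⟩ := exists_exchange_injection M hS hT
  have hg : 0 ≤ f S - f ∅ := sub_nonneg.2 (hf.mono _ _ (Finset.empty_subset _) hSV)
  -- The loss charged to `t`: nothing if `t` can be added freely, otherwise the cost of removing its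
  -- partner in `S`.
  let l : α → ℝ := fun t =>
    if h : t ∈ T ∧ ¬ M.Indep (insert t S : Finset α) then f S - f (S.erase (p ⟨t, h⟩)) else 0
  have hl : ∑ t ∈ T, l t ≤ f S - f ∅ := by
    have h1 : ∑ t ∈ T, l t = ∑ t ∈ T.filter (fun t => ¬ M.Indep (insert t S : Finset α)), l t := by
      rw [Finset.sum_filter]
      refine Finset.sum_congr rfl fun t ht => ?_
      by_cases h : M.Indep (insert t S : Finset α)
      · rw [if_neg (not_not.2 h)]
        exact dif_neg fun h' => h'.2 h
      · rw [if_pos h]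
    -- A total extension of `p`, needed only to reindex the sum; its values off the filtered set are
    -- irrelevant.
    let q : α → α := fun t =>
      if h : t ∈ T ∧ ¬ M.Indep (insert t S : Finset α) then p ⟨t, h⟩ else t
    have h2 : ∑ t ∈ T.filter (fun t => ¬ M.Indep (insert t S : Finset α)), l t =
        ∑ y ∈ (T.filter (fun t => ¬ M.Indep (insert t S : Finset α))).image q,
          (f S - f (S.erase y)) := by
      rw [Finset.sum_image]
      · refine Finset.sum_congr rfl fun t ht => ?_
        have ht' := Finset.mem_filter.1 ht
        simp only [l, q, dif_pos ht']
      · intro a ha b hb hab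
        have ha' := Finset.mem_filter.1 ha
        have hb' := Finset.mem_filter.1 hb
        simp only [q, dif_pos ha', dif_pos hb'] at hab
        exact congrArg Subtype.val (hp hab)
    rw [h1, h2]
    refine hf.sum_sub_erase_le hSV _ ?_
    intro y hy
    obtain ⟨t, ht, rfl⟩ := Finset.mem_image.1 hy
    have ht' := Finset.mem_filter.1 ht
    simp only [q, dif_pos ht']
    exact (hpS _).1
  have hpt : ∀ t ∈ T, f (insert t S) - f S ≤ δ * (f S - f ∅) + l t := by
    intro t ht
    have hl0 : 0 ≤ l t := by
      simp only [l]
      split_ifs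
      · exact sub_nonneg.2 (hf.mono _ _ (Finset.erase_subset _ _) hSV)
      · exact le_rfl
    rcases hopt t ht with h | h
    · have := hf.insert_sub_le (Finset.empty_subset S) hSV (hTV ht)
      rw [insert_empty_eq] at this
      linarith
    · by_cases hi : M.Indep (insert t S : Finset α)
      · have := not_lt.1 fun h' => h _ (insert_mem_swaps S t) ⟨hi, h'⟩
        linarith
      · have hlt : l t = f S - f (S.erase (p ⟨t, ht, hi⟩)) := dif_pos ⟨ht, hi⟩
        obtain ⟨h1, h2⟩ := hpS ⟨t, ht, hi⟩
        have h3 := not_lt.1 fun h' => h _ (insert_erase_mem_swaps h1 t) ⟨h2, h'⟩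
        have h4 := hf.insert_sub_le (Finset.erase_subset (p ⟨t, ht, hi⟩) S) hSV (hTV ht)
        rw [hlt]
        linarith
  have h1 := hf.union_sub_le_sum hSV T hTV
  have h2 := Finset.sum_le_sum hpt
  rw [Finset.sum_add_distrib, Finset.sum_const, nsmul_eq_mul] at h2
  have h3 := hf.mono T (S ∪ T) Finset.subset_union_right (Finset.union_subset hSV hTV)
  have h4 : (T.card : ℝ) * (δ * (f S - f ∅)) ≤ k * (δ * (f S - f ∅)) :=
    mul_le_mul_of_nonneg_right (by exact_mod_cast hk) (mul_nonneg hδ hg)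
  linarith

end DynamicSubmodular

/-! ### The dynamic algorithm and its amortized analysis -/

namespace DynamicSubmodular

variable {α : Type u}

open Classical in
/-- Go through the list of candidates until one is found that improves on `S`; continue with `yes`
for it, and with `no` if there is none. -/
noncomputable def firstImproving {β : Type v} (δ : ℝ) (S : Finset α) (no : QueryProgram α β)
    (yes : Finset α → QueryProgram α β) : List (Finset α) → QueryProgram α β
  | [] => no
  | T :: Ts =>
    .indep T
      (.value T fun a => .value S fun b => .value ∅ fun z =>
        if (1 + δ) * (b - z) < a - z then yes T else firstImproving δ S no yes Ts)
      (firstImproving δ S no yes Ts)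

/-- Separates the search from its continuation: `pre` is what the search asks, `P` the branch it
takes. The factor 4 is one independence query and up to three value queries per candidate, since `f
S` and `f ∅` are asked anew each time. -/
theorem firstImproving_spec {β : Type v} (f : Finset α → ℝ) (M : Matroid α) (δ : ℝ)
    (S : Finset α) (no : QueryProgram α β) (yes : Finset α → QueryProgram α β)
    (Ts : List (Finset α)) :
    ∃ P : QueryProgram α β, ∃ pre : List (Finset α),
      (firstImproving δ S no yes Ts).result f M = P.result f M ∧
      (firstImproving δ S no yes Ts).queries f M = pre ++ P.queries f M ∧
      pre.length ≤ 4 * Ts.length ∧ (∀ Q ∈ pre, Q = ∅ ∨ Q = S ∨ Q ∈ Ts) ∧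
      ((P = no ∧ ∀ T ∈ Ts, ¬ Improves f M δ S T) ∨
        ∃ T ∈ Ts, P = yes T ∧ Improves f M δ S T) := by
  induction Ts with
  | nil => exact ⟨no, [], by simp [firstImproving]⟩
  | cons T Ts ih =>
    obtain ⟨P, pre, h1, h2, h3, h4, h5⟩ := ih
    by_cases hi : M.Indep (T : Set α)
    · by_cases hlt : (1 + δ) * (f S - f ∅) < f T - f ∅
      · refine ⟨yes T, [T, T, S, ∅], ?_, ?_, ?_, ?_, Or.inr ⟨T, by simp, rfl, hi, hlt⟩⟩
        · simp [firstImproving, QueryProgram.result, hi, hlt]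
        · simp [firstImproving, QueryProgram.queries, hi, hlt]
        · simp only [List.length_cons, List.length_nil]
          lia
        · simp
      · refine ⟨P, [T, T, S, ∅] ++ pre, ?_, ?_, ?_, ?_, ?_⟩
        · simp [firstImproving, QueryProgram.result, hi, hlt, h1]
        · simp [firstImproving, QueryProgram.queries, hi, hlt, h2]
        · simp only [List.length_append, List.length_cons, List.length_nil]
          lia
        · simp only [List.mem_append, List.mem_cons, List.not_mem_nil]
          grind
        · rcases h5 with ⟨h5, h6⟩ | ⟨R, hR, h5, h6⟩
          · refine Or.inl ⟨h5, List.forall_mem_cons.2 ⟨fun h => hlt h.2, h6⟩⟩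
          · exact Or.inr ⟨R, List.mem_cons_of_mem _ hR, h5, h6⟩
    · refine ⟨P, T :: pre, ?_, ?_, ?_, ?_, ?_⟩
      · simp [firstImproving, QueryProgram.result, hi, h1]
      · simp [firstImproving, QueryProgram.queries, hi, h2]
      · simp only [List.length_cons]
        lia
      · simp only [List.mem_cons]
        grind
      · rcases h5 with ⟨h5, h6⟩ | ⟨R, hR, h5, h6⟩
        · refine Or.inl ⟨h5, List.forall_mem_cons.2 ⟨fun h => hi h.1, h6⟩⟩
        · exact Or.inr ⟨R, List.mem_cons_of_mem _ hR, h5, h6⟩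

/-- Decrease all counters, and remove the elements whose counter is zero already. -/
def age : List (α × ℕ) → List (α × ℕ)
  | [] => []
  | (_, 0) :: L => age L
  | (x, c + 1) :: L => (x, c) :: age L

/-- The sum of all counters. -/
def totalCount (L : List (α × ℕ)) : ℕ := (L.map Prod.snd).sum

theorem mem_age {L : List (α × ℕ)} {x : α} {c : ℕ} : (x, c) ∈ age L ↔ (x, c + 1) ∈ L := by
  induction L with
  | nil => simp [age]
  | cons p L ih =>
    obtain ⟨y, _ | d⟩ := p <;> simp [age, ih]

/-- Each surviving element gives up one unit, which pays for its part in the next scan. -/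
theorem totalCount_age (L : List (α × ℕ)) :
    totalCount (age L) + (age L).length = totalCount L := by
  induction L with
  | nil => simp [age, totalCount]
  | cons p L ih =>
    obtain ⟨y, _ | d⟩ := p <;> simp [age, totalCount] at ih ⊢ <;> lia

variable [DecidableEq α]

/-- All the sets obtained from `S` by adding one of the listed elements and removing at most one
element. -/
noncomputable def allSwaps (S : Finset α) (L : List (α × ℕ)) : List (Finset α) :=
  L.flatMap fun p => swaps S p.1

theorem length_allSwaps (S : Finset α) (L : List (α × ℕ)) :
    (allSwaps S L).length = L.length * (S.card + 1) := by
  simp [allSwaps, List.length_flatMap, length_swaps]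

theorem mem_allSwaps {S T : Finset α} {L : List (α × ℕ)} :
    T ∈ allSwaps S L ↔ ∃ p ∈ L, T ∈ swaps S p.1 := by
  simp [allSwaps]

/-- Replace `S` by improving swaps with the listed elements, each of which takes part in as many
scans as its counter says, until no such swap is left. -/
noncomputable def improve (δ : ℝ) : ℕ → Finset α → List (α × ℕ) →
    QueryProgram α (Finset α × List (α × ℕ))
  | 0, S, _ => .done (S, [])
  | n + 1, S, L =>
    firstImproving δ S (.done (S, age L)) (fun T => improve δ n T (age L)) (allSwaps S (age L))

/-- Process the insertion of `e` in the state `s`. -/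
noncomputable def insertElement (δ : ℝ) (N : ℕ) (s : Finset α × List (α × ℕ)) (e : α) :
    QueryProgram α (Finset α × List (α × ℕ)) :=
  firstImproving δ s.1 (.done (s.1, (e, N) :: s.2)) (fun T => improve δ N T ((e, N) :: s.2))
    (swaps s.1 e)

/-- Dynamic local search. The state is the current solution with a list of the elements that may
still be worth a swap, each with the number of scans it may still take part in. -/
noncomputable def localSearch (α : Type u) [DecidableEq α] (δ : ℝ) (N : ℕ) :
    DynamicAlgorithm α where
  State := Finset α × List (α × ℕ)
  start := (∅, [])
  insert := insertElement δ N
  output := Prod.fst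

/-- Every element of `W` that is not a loop has a small gain, or it is in the list `L` with a
counter that bounds its gain. -/
def Covered (f : Finset α → ℝ) (M : Matroid α) (δ μ : ℝ) (N r : ℕ) (W S : Finset α)
    (L : List (α × ℕ)) : Prop :=
  ∀ x ∈ W, M.Indep {x} → f {x} - f ∅ ≤ μ * (f S - f ∅) ∨
    ∃ c, (x, c) ∈ L ∧ (f {x} - f ∅) * (1 + δ) ^ N ≤ (1 + δ) ^ (c + r) * (f S - f ∅)

/-- The state `s` after the insertion of the elements of `W` is locally optimal. -/
structure Settled (f : Finset α → ℝ) (M : Matroid α) (δ μ : ℝ) (N : ℕ) (W : Finset α)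
    (s : Finset α × List (α × ℕ)) : Prop where
  subset : s.1 ⊆ W
  indep : M.Indep (s.1 : Set α)
  mem : ∀ p ∈ s.2, p.1 ∈ W
  count_le : ∀ p ∈ s.2, p.2 ≤ N
  covered : Covered f M δ μ N 1 W s.1 s.2
  opt : ∀ p ∈ s.2, ∀ T ∈ swaps s.1 p.1, ¬ Improves f M δ s.1 T

variable {f : Finset α → ℝ} {M : Matroid α} {V W : Finset α} {δ μ : ℝ} {N k : ℕ}

/-- Lowering a counter by one raises the slack `r` from 0 to 1. An element whose counter is already
zero has gain at most `(1 + δ)^(-N)` times that of `S`, hence is negligible by `hN` and may be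
dropped. -/
theorem Covered.age {S : Finset α} {L : List (α × ℕ)}
    (hf : IsMonotoneSubmodular V f) (hWV : W ⊆ V) (hμ : 0 ≤ μ) (hN : 1 ≤ μ * (1 + δ) ^ N)
    (h : Covered f M δ μ N 0 W S L) : Covered f M δ μ N 1 W S (age L) := by
  intro x hx hxi
  rcases h x hx hxi with h | ⟨_ | c, hc, h⟩
  · exact Or.inl h
  · left
    have hg : 0 ≤ f {x} - f ∅ := sub_nonneg.2
      (hf.mono _ _ (Finset.empty_subset _) (by simpa using hWV hx))
    rw [Nat.add_zero, pow_zero, one_mul] at h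
    calc f {x} - f ∅ ≤ (f {x} - f ∅) * (μ * (1 + δ) ^ N) := le_mul_of_one_le_right hg hN
      _ = μ * ((f {x} - f ∅) * (1 + δ) ^ N) := by ring
      _ ≤ μ * (f S - f ∅) := mul_le_mul_of_nonneg_left h hμ
  · exact Or.inr ⟨c, mem_age.2 hc, h⟩

/-- The fuel `n` bounds all counters and decreases with them, so once it runs out aging would empty
the list, and returning `[]` loses nothing. -/
theorem improve_spec (hf : IsMonotoneSubmodular V f) (hWV : W ⊆ V) (hδ : 0 ≤ δ) (hμ : 0 ≤ μ)
    (hN : 1 ≤ μ * (1 + δ) ^ N) (hk : ∀ S : Finset α, M.Indep (S : Set α) → S.card ≤ k)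
    (n : ℕ) (hn : n ≤ N) (S : Finset α) (L : List (α × ℕ)) (hS : S ⊆ W)
    (hSi : M.Indep (S : Set α)) (hLW : ∀ p ∈ L, p.1 ∈ W) (hLn : ∀ p ∈ L, p.2 ≤ n)
    (hL : Covered f M δ μ N 0 W S L) :
    Settled f M δ μ N W ((improve δ n S L).result f M) ∧
    ((improve δ n S L).queries f M).length +
      4 * (k + 1) * totalCount ((improve δ n S L).result f M).2 ≤ 4 * (k + 1) * totalCount L ∧
    ∀ Q ∈ (improve δ n S L).queries f M, Q ⊆ W := by
  induction n generalizing S L with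
  | zero =>
    simp only [improve, QueryProgram.result, QueryProgram.queries]
    have hage : age L = [] := by
      rw [List.eq_nil_iff_forall_not_mem]
      rintro ⟨x, c⟩ hx
      exact absurd (hLn _ (mem_age.1 hx)) (by simp)
    have := hL.age hf hWV hμ hN
    rw [hage] at this
    exact ⟨⟨hS, hSi, by simp, by simp, this, by simp⟩, by simp [totalCount], by simp⟩
  | succ n ih =>
    obtain ⟨P, pre, h1, h2, h3, h4, h5⟩ := firstImproving_spec f M δ S (.done (S, age L))
      (fun T => improve δ n T (age L)) (allSwaps S (age L))
    have hage := hL.age hf hWV hμ hN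
    have hageW : ∀ p ∈ age L, p.1 ∈ W := fun p hp => hLW (p.1, p.2 + 1) (mem_age.1 hp)
    have hagen : ∀ p ∈ age L, p.2 ≤ n := fun p hp =>
      Nat.le_of_succ_le_succ (hLn (p.1, p.2 + 1) (mem_age.1 hp))
    have hsub : ∀ T ∈ allSwaps S (age L), T ⊆ W := by
      intro T hT
      obtain ⟨p, hp, hT⟩ := mem_allSwaps.1 hT
      exact (subset_insert_of_mem_swaps hT).trans (Finset.insert_subset (hageW p hp) hS)
    have hpre : ∀ Q ∈ pre, Q ⊆ W := by
      intro Q hQ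
      rcases h4 Q hQ with rfl | rfl | h
      · exact Finset.empty_subset _
      · exact hS
      · exact hsub Q h
    have hlen : pre.length ≤ 4 * (k + 1) * (age L).length := by
      refine h3.trans ?_
      rw [length_allSwaps]
      calc _ ≤ 4 * ((age L).length * (k + 1)) := by gcongr; exact hk S hSi
        _ = _ := by ring
    rw [← totalCount_age L, Nat.mul_add]
    simp only [improve]
    rw [h1, h2]
    rcases h5 with ⟨rfl, h6⟩ | ⟨T, hT, rfl, h6⟩
    · simp only [QueryProgram.result, QueryProgram.queries, List.append_nil]
      refine ⟨⟨hS, hSi, hageW, fun p hp => (hagen p hp).trans (by lia), hage, ?_⟩, by lia, hpre⟩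
      intro p hp T hT
      exact h6 T (mem_allSwaps.2 ⟨p, hp, hT⟩)
    -- The improving swap contributes a factor `1 + δ`, which brings the slack back from 1 to 0.
    · obtain ⟨i1, i2, i3⟩ := ih (by lia) T (age L) (hsub T hT) h6.1 hageW hagen (by
        intro x hx hxi
        rcases hage x hx hxi with h | ⟨c, hc, h⟩
        · left
          refine h.trans (mul_le_mul_of_nonneg_left ?_ hμ)
          have hg : 0 ≤ f S - f ∅ := sub_nonneg.2
            (hf.mono _ _ (Finset.empty_subset _) (hS.trans hWV))
          nlinarith [h6.2]
        · refine Or.inr ⟨c, hc, h.trans ?_⟩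
          rw [pow_succ, mul_assoc]
          exact mul_le_mul_of_nonneg_left h6.2.le (by positivity))
      refine ⟨i1, ?_, ?_⟩
      · rw [List.length_append]
        lia
      · intro Q hQ
        rcases List.mem_append.1 hQ with h | h
        · exact hpre Q h
        · exact i3 Q h

/-- Of the `N + 1` units credited, `N` go to the counter of `e` and one pays for testing `e`. If the
test finds nothing, `S` is unchanged and the old list needs no rescan. -/
theorem insertElement_spec (hf : IsMonotoneSubmodular V f) (hWV : W ⊆ V) (hδ : 0 ≤ δ)
    (hμ : 0 ≤ μ) (hN : 1 ≤ μ * (1 + δ) ^ N)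
    (hk : ∀ S : Finset α, M.Indep (S : Set α) → S.card ≤ k) {s : Finset α × List (α × ℕ)}
    (hs : Settled f M δ μ N W s) {e : α} (he : e ∈ V) :
    Settled f M δ μ N (insert e W) ((insertElement δ N s e).result f M) ∧
    ((insertElement δ N s e).queries f M).length +
      4 * (k + 1) * totalCount ((insertElement δ N s e).result f M).2 ≤
        4 * (k + 1) * totalCount s.2 + 4 * (k + 1) * (N + 1) ∧
    ∀ Q ∈ (insertElement δ N s e).queries f M, Q ⊆ insert e W := by
  obtain ⟨S, L⟩ := s
  obtain ⟨hS, hSi, hLW, hLN, hL, hopt⟩ := hs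
  simp only at hS hSi hLW hLN hL hopt
  obtain ⟨P, pre, h1, h2, h3, h4, h5⟩ := firstImproving_spec f M δ S (.done (S, (e, N) :: L))
      (fun T => improve δ N T ((e, N) :: L)) (swaps S e)
  have hW'V : insert e W ⊆ V := Finset.insert_subset he hWV
  have hS' : S ⊆ insert e W := hS.trans (Finset.subset_insert _ _)
  have hsub : ∀ T ∈ swaps S e, T ⊆ insert e W := fun T hT =>
    (subset_insert_of_mem_swaps hT).trans (Finset.insert_subset_insert e hS)
  have hpre : ∀ Q ∈ pre, Q ⊆ insert e W := by
    intro Q hQ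
    rcases h4 Q hQ with rfl | rfl | h
    · exact Finset.empty_subset _
    · exact hS'
    · exact hsub Q h
  have hlen : pre.length ≤ 4 * (k + 1) := by
    refine h3.trans ?_
    rw [length_swaps]
    have := hk S hSi
    lia
  have hL'W : ∀ p ∈ (e, N) :: L, p.1 ∈ insert e W :=
    List.forall_mem_cons.2 ⟨Finset.mem_insert_self _ _,
      fun p hp => Finset.mem_insert_of_mem (hLW p hp)⟩
  have hL'N : ∀ p ∈ (e, N) :: L, p.2 ≤ N := List.forall_mem_cons.2 ⟨le_rfl, hLN⟩
  have hgain : ∀ T ∈ swaps S e, f {e} - f ∅ ≤ f T - f ∅ := fun T hT =>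
    sub_le_sub_right (hf.mono _ _ (Finset.singleton_subset_iff.2 (mem_of_mem_swaps hT))
      ((hsub T hT).trans hW'V)) _
  have hcount : totalCount ((e, N) :: L) = N + totalCount L := by simp [totalCount]
  simp only [insertElement]
  rw [h1, h2]
  rcases h5 with ⟨rfl, h6⟩ | ⟨T, hT, rfl, h6⟩
  · simp only [QueryProgram.result, QueryProgram.queries, List.append_nil]
    refine ⟨⟨hS', hSi, hL'W, hL'N, ?_, List.forall_mem_cons.2 ⟨h6, hopt⟩⟩, ?_, hpre⟩
    · intro x hx hxi
      rcases Finset.mem_insert.1 hx with rfl | hx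
      · right
        refine ⟨N, List.mem_cons_self, ?_⟩
        obtain ⟨T, hT, hTi⟩ := exists_indep_mem_swaps hSi hxi
        have h7 := (hgain T hT).trans (not_lt.1 fun h' => h6 T hT ⟨hTi, h'⟩)
        calc (f {x} - f ∅) * (1 + δ) ^ N ≤ (1 + δ) * (f S - f ∅) * (1 + δ) ^ N :=
              mul_le_mul_of_nonneg_right h7 (by positivity)
          _ = (1 + δ) ^ (N + 1) * (f S - f ∅) := by ring
      · rcases hL x hx hxi with h | ⟨c, hc, h⟩
        · exact Or.inl h
        · exact Or.inr ⟨c, List.mem_cons_of_mem _ hc, h⟩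
    · rw [hcount]
      lia
  · obtain ⟨i1, i2, i3⟩ := improve_spec hf hW'V hδ hμ hN hk N le_rfl T ((e, N) :: L) (hsub T hT)
      h6.1 hL'W hL'N (by
        intro x hx hxi
        rcases Finset.mem_insert.1 hx with rfl | hx
        · refine Or.inr ⟨N, List.mem_cons_self, ?_⟩
          rw [Nat.add_zero, mul_comm]
          exact mul_le_mul_of_nonneg_left (hgain T hT) (by positivity)
        · rcases hL x hx hxi with h | ⟨c, hc, h⟩
          · left
            refine h.trans (mul_le_mul_of_nonneg_left ?_ hμ)
            have hg : 0 ≤ f S - f ∅ := sub_nonneg.2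
              (hf.mono _ _ (Finset.empty_subset _) (hS.trans hWV))
            nlinarith [h6.2]
          · refine Or.inr ⟨c, List.mem_cons_of_mem _ hc, h.trans ?_⟩
            rw [pow_succ, mul_assoc]
            exact mul_le_mul_of_nonneg_left h6.2.le (by positivity))
    refine ⟨i1, ?_, ?_⟩
    · rw [hcount] at i2
      rw [List.length_append]
      lia
    · intro Q hQ
      rcases List.mem_append.1 hQ with h | h
      · exact hpre Q h
      · exact i3 Q h

theorem localSearch_run_spec (hf : IsMonotoneSubmodular V f) (hδ : 0 ≤ δ)
    (hμ : 0 ≤ μ) (hN : 1 ≤ μ * (1 + δ) ^ N)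
    (hk : ∀ S : Finset α, M.Indep (S : Set α) → S.card ≤ k) (σ : List α) (hσ : ∀ e ∈ σ, e ∈ V) :
    Settled f M δ μ N σ.toFinset ((localSearch α δ N).run f M σ).1 ∧
    ((localSearch α δ N).run f M σ).2 +
      4 * (k + 1) * totalCount ((localSearch α δ N).run f M σ).1.2 ≤
        σ.length * (4 * (k + 1) * (N + 1)) := by
  induction σ using List.reverseRecOn with
  | nil =>
    refine ⟨⟨?_, ?_, ?_, ?_, ?_, ?_⟩, ?_⟩ <;>
      simp [DynamicAlgorithm.run, localSearch, totalCount, Covered]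
  | append_singleton σ e ih =>
    obtain ⟨i1, i2⟩ := ih fun x hx => hσ x (List.mem_append_left _ hx)
    have hrun : (localSearch α δ N).run f M (σ ++ [e]) =
        ((insertElement δ N ((localSearch α δ N).run f M σ).1 e).result f M,
          ((localSearch α δ N).run f M σ).2 +
            ((insertElement δ N ((localSearch α δ N).run f M σ).1 e).queries f M).length) := by
      rw [DynamicAlgorithm.run, List.foldl_append]
      rfl
    obtain ⟨j1, j2, -⟩ := insertElement_spec hf
      (fun x hx => hσ x (List.mem_append_left _ (List.mem_toFinset.1 hx))) hδ hμ hN hk i1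
      (hσ e (by simp))
    rw [hrun]
    refine ⟨?_, ?_⟩
    · have : (σ ++ [e]).toFinset = insert e σ.toFinset := by
        ext x
        simp
      rw [this]
      exact j1
    · rw [List.length_append, List.length_singleton, Nat.add_mul, Nat.one_mul]
      simp only
      lia

end DynamicSubmodular

/-! ### Approximation ratio and query bound -/

namespace DynamicSubmodular

variable {α : Type u} {f : Finset α → ℝ} {M : Matroid α} {V W : Finset α}

theorem isApproxSolution_of_forall {γ : ℝ} {S : Finset α} (hSW : S ⊆ W)
    (hS : M.Indep (S : Set α))
    (h : ∀ T : Finset α, T ⊆ W → M.Indep (T : Set α) → γ * f T ≤ f S) :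
    IsApproxSolution γ f M W S := by
  classical
  obtain ⟨T, hT, hopt⟩ := Finset.exists_mem_eq_sup' (feasibleSets_nonempty M W) f
  obtain ⟨hTW, hTi⟩ := Finset.mem_filter.1 hT
  refine ⟨hSW, hS, ?_⟩
  rw [opt, hopt]
  exact h T (Finset.mem_powerset.1 hTW) hTi

theorem card_le_of_eRank_eq {k : ℕ} (hk : M.eRank = (k : ℕ∞)) (S : Finset α)
    (hS : M.Indep (S : Set α)) : S.card ≤ k := by
  have h := hS.encard_le_eRank
  rw [hk, Set.encard_coe_eq_coe_finsetCard] at h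
  exact_mod_cast h

/-- The algorithm that maintains the empty set and makes no queries. -/
def emptyAlgorithm (α : Type u) : DynamicAlgorithm α where
  State := PUnit
  start := ⟨⟩
  insert _ _ := .done ⟨⟩
  output _ := ∅

theorem emptyAlgorithm_queryCount (f : Finset α → ℝ) (M : Matroid α) (σ : List α) :
    (emptyAlgorithm α).queryCount f M σ = 0 := by
  induction σ using List.reverseRecOn with
  | nil => rfl
  | append_singleton σ e ih =>
    rw [DynamicAlgorithm.queryCount, DynamicAlgorithm.run, List.foldl_append]
    exact ih

variable [DecidableEq α]

theorem Settled.approx {δ ε : ℝ} {N k : ℕ} {s : Finset α × List (α × ℕ)}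
    (hf : IsMonotoneSubmodular V f) (hWV : W ⊆ V) (hδ : 0 ≤ δ) (hε : 0 ≤ ε) (hε2 : ε ≤ 1 / 2)
    (hkδ : k * δ ≤ ε) (hk : ∀ S : Finset α, M.Indep (S : Set α) → S.card ≤ k)
    (hs : Settled f M δ δ N W s) {T : Finset α} (hT : T ⊆ W) (hTi : M.Indep (T : Set α)) :
    (1 / 2 - ε) * f T ≤ f s.1 := by
  have h := gain_le_of_locally_optimal hf hδ (hs.subset.trans hWV) (hT.trans hWV) hs.indep hTi
    (hk T hTi) (by
      intro t ht
      rcases hs.covered t (hT ht) (hTi.subset (by simpa using ht)) with h | ⟨c, hc, -⟩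
      · exact Or.inl h
      · exact Or.inr (hs.opt _ hc))
  have hg : 0 ≤ f s.1 - f ∅ := sub_nonneg.2
    (hf.mono _ _ (Finset.empty_subset _) (hs.subset.trans hWV))
  have h0 := hf.nonneg ∅ (Finset.empty_subset _)
  have h1 : f T - f ∅ ≤ (2 + ε) * (f s.1 - f ∅) := h.trans (by gcongr)
  have h2 : (1 / 2 - ε) * (f T - f ∅) ≤ (1 / 2 - ε) * ((2 + ε) * (f s.1 - f ∅)) :=
    mul_le_mul_of_nonneg_left h1 (by linarith)
  -- Here `(1/2 - ε)(2 + ε) = 1 - 3ε/2 - ε² ≤ 1`.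
  nlinarith [mul_nonneg hε hg, mul_nonneg (mul_nonneg hε hε) hg, mul_nonneg hε h0]

/-- For `δ = 0`, `μ = 1`, `N = 0` both alternatives of `Covered` say that the gain of `{x}` is at
most that of `S`, so the solution is exactly optimal. -/
theorem Settled.le_of_rank_le_one {s : Finset α × List (α × ℕ)}
    (hf : IsMonotoneSubmodular V f) (hWV : W ⊆ V)
    (hk : ∀ S : Finset α, M.Indep (S : Set α) → S.card ≤ 1)
    (hs : Settled f M 0 1 0 W s) {T : Finset α} (hT : T ⊆ W) (hTi : M.Indep (T : Set α)) :
    f T ≤ f s.1 := by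
  rcases T.eq_empty_or_nonempty with rfl | hne
  · exact hf.mono _ _ (Finset.empty_subset _) (hs.subset.trans hWV)
  · obtain ⟨x, rfl⟩ := Finset.card_eq_one.1 (le_antisymm (hk T hTi) hne.card_pos)
    rcases hs.covered x (by simpa using hT) (by simpa using hTi) with h | ⟨c, -, h⟩
    · linarith
    · simpa using h

theorem localSearch_spec {δ μ γ B : ℝ} {N k : ℕ} (hV : M.eRank = (k : ℕ∞))
    (hf : IsMonotoneSubmodular V f) (hδ : 0 ≤ δ) (hμ : 0 ≤ μ) (hN : 1 ≤ μ * (1 + δ) ^ N)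
    (happrox : ∀ W : Finset α, W ⊆ V → ∀ s : Finset α × List (α × ℕ), Settled f M δ μ N W s →
      ∀ T : Finset α, T ⊆ W → M.Indep (T : Set α) → γ * f T ≤ f s.1)
    (hB : 4 * ((k : ℝ) + 1) * (N + 1) ≤ B) (σ : List α) (hσ : ∀ e ∈ σ, e ∈ V) :
    (∀ i ≤ σ.length, IsApproxSolution γ f M (σ.take i).toFinset
      ((localSearch α δ N).solution f M (σ.take i))) ∧
    (∀ i ≤ σ.length, ((localSearch α δ N).queryCount f M (σ.take i) : ℝ) ≤ i * B) ∧
    (∀ (i : ℕ) (hi : i < σ.length), ∀ Q ∈ (localSearch α δ N).roundQueries f M (σ.take i) σ[i],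
      Q ⊆ (σ.take (i + 1)).toFinset) := by
  have hk := card_le_of_eRank_eq hV
  have hσi : ∀ i, ∀ e ∈ σ.take i, e ∈ V := fun i e he => hσ e (List.mem_of_mem_take he)
  have hrun := fun i => localSearch_run_spec hf hδ hμ hN hk (σ.take i) (hσi i)
  have hsub : ∀ i, (σ.take i).toFinset ⊆ V := fun i e he => hσi i e (List.mem_toFinset.1 he)
  refine ⟨fun i _ => ?_, fun i hi => ?_, fun i hi Q hQ => ?_⟩
  · have h := (hrun i).1
    exact isApproxSolution_of_forall h.subset h.indep (happrox _ (hsub i) _ h)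
  · have h := (Nat.le_add_right _ _).trans (hrun i).2
    rw [List.length_take_of_le hi] at h
    have h' : ((localSearch α δ N).queryCount f M (σ.take i) : ℝ) ≤
        i * (4 * ((k : ℝ) + 1) * (N + 1)) := by exact_mod_cast h
    exact h'.trans (mul_le_mul_of_nonneg_left hB (Nat.cast_nonneg i))
  · have h := (insertElement_spec hf (hsub i) hδ hμ hN hk (hrun i).1
      (hσ _ (List.getElem_mem hi))).2.2 Q hQ
    refine h.trans fun x hx => ?_
    rw [List.take_succ_eq_append_getElem hi]
    simpa [-List.take_append_getElem, or_comm] using hx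

theorem query_bound {ε : ℝ} {k : ℕ} (hε : 0 < ε) (hε2 : ε ≤ 1 / 2) (hk : 2 ≤ k) :
    4 * ((k : ℝ) + 1) * ((⌈((k : ℝ) / ε) ^ 2⌉₊ : ℝ) + 1) ≤ 16 * (k : ℝ) ^ (4 * (1 / ε)) := by
  have hk2 : (2 : ℝ) ≤ k := by exact_mod_cast hk
  have hx : 2 ≤ 1 / ε := by rw [le_div_iff₀ hε]; linarith
  rw [div_eq_mul_one_div]
  generalize 1 / ε = x at hx ⊢
  generalize (k : ℝ) = K at hk2 ⊢
  have hceil := (Nat.ceil_lt_add_one (sq_nonneg (K * x))).le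
  have hKx : 4 ≤ K * x := by nlinarith
  have h1 : (⌈(K * x) ^ 2⌉₊ : ℝ) + 1 ≤ 2 * (K * x) ^ 2 := by nlinarith
  -- Bernoulli gives `1 + x ≤ 2 ^ x`; this is where `K ≥ 2` turns the factor `1/ε` into a power of
  -- `k`.
  have hxK : x ≤ K ^ x := by
    have h := one_add_mul_self_le_rpow_one_add (s := 1) (by norm_num) (by linarith : 1 ≤ x)
    have h' : ((1 : ℝ) + 1) ^ x ≤ K ^ x :=
      Real.rpow_le_rpow (by norm_num) (by linarith) (by linarith)
    linarith
  have hK3 : K ^ 3 ≤ K ^ (2 * x) := by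
    rw [← Real.rpow_natCast]
    exact Real.rpow_le_rpow_of_exponent_le (by linarith) (by push_cast; linarith)
  have hpow : K ^ (4 * x) = K ^ (2 * x) * (K ^ x) ^ 2 := by
    rw [← Real.rpow_natCast, ← Real.rpow_mul (by linarith), ← Real.rpow_add (by linarith)]
    congr 1
    push_cast
    ring
  calc 4 * (K + 1) * ((⌈(K * x) ^ 2⌉₊ : ℝ) + 1) ≤ 4 * (2 * K) * (2 * (K * x) ^ 2) := by
        gcongr
        linarith
    _ = 16 * (K ^ 3 * x ^ 2) := by ring
    _ ≤ 16 * (K ^ (2 * x) * (K ^ x) ^ 2) := by gcongr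
    _ = 16 * K ^ (4 * x) := by rw [hpow]

end DynamicSubmodular

/-! ### Choice of parameters -/

theorem mainTheorem5 :
    ∃ C : ℝ, 0 < C ∧ ∃ c : ℝ, 0 < c ∧ ∃ d : ℕ,
      ∀ (α : Type u) [DecidableEq α] (ε : ℝ), 0 < ε → ∀ k : ℕ,
        ∃ A : DynamicSubmodular.DynamicAlgorithm α,
          ∀ (V : Finset α) (M : Matroid α) (f : Finset α → ℝ),
            M.E = (V : Set α) → M.eRank = (k : ℕ∞) →
            DynamicSubmodular.IsMonotoneSubmodular V f →
            ∀ σ : List α, (∀ e ∈ σ, e ∈ V) →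
              (∀ i ≤ σ.length,
                DynamicSubmodular.IsApproxSolution (1 / 2 - ε) f M (σ.take i).toFinset
                  (A.solution f M (σ.take i))) ∧
              (∀ i ≤ σ.length,
                (A.queryCount f M (σ.take i) : ℝ) ≤
                  (i : ℝ) * (C * (k : ℝ) ^ (c * (1 / ε) * Real.log (2 + 1 / ε) ^ d))) ∧
              (∀ (i : ℕ) (hi : i < σ.length),
                ∀ Q ∈ A.roundQueries f M (σ.take i) σ[i],
                  Q ⊆ (σ.take (i + 1)).toFinset) := by
  refine ⟨16, by norm_num, 4, by norm_num, 0, fun α _ ε hε k => ?_⟩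
  simp only [pow_zero, mul_one]
  -- For `k = 0` only `∅` is feasible and the bound allows no queries; for `ε ≥ 1/2` the required
  -- ratio is not positive.
  by_cases htriv : k = 0 ∨ 1 / 2 ≤ ε
  · refine ⟨DynamicSubmodular.emptyAlgorithm α, fun V M f _ hr hf σ hσ => ⟨fun i _ => ?_,
      fun i _ => ?_, fun i hi Q hQ => ?_⟩⟩
    · have h0 := hf.nonneg ∅ (Finset.empty_subset _)
      refine DynamicSubmodular.isApproxSolution_of_forall (Finset.empty_subset _)
        (by simp [DynamicSubmodular.DynamicAlgorithm.solution, DynamicSubmodular.emptyAlgorithm])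
        fun T hT hTi => ?_
      change (1 / 2 - ε) * f T ≤ f ∅
      rcases htriv with rfl | h
      · have hT0 := DynamicSubmodular.card_le_of_eRank_eq hr T hTi
        rw [Nat.le_zero, Finset.card_eq_zero] at hT0
        subst hT0
        nlinarith
      · have hTV : T ⊆ V := fun x hx =>
          hσ x (List.mem_of_mem_take (List.mem_toFinset.1 (hT hx)))
        nlinarith [hf.nonneg T hTV]
    · rw [DynamicSubmodular.emptyAlgorithm_queryCount]
      rw [Nat.cast_zero]
      positivity
    · simp [DynamicSubmodular.DynamicAlgorithm.roundQueries, DynamicSubmodular.emptyAlgorithm,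
        DynamicSubmodular.QueryProgram.queries] at hQ
  · obtain ⟨hk0, hε2⟩ := not_or.1 htriv
    rw [not_le] at hε2
    -- Powers of `k = 1` are constant, so the cost must not depend on `ε`: no rescans are made, with
    -- `N = 0`.
    by_cases hk1 : k = 1
    · subst hk1
      refine ⟨DynamicSubmodular.localSearch α 0 0, fun V M f _ hr hf =>
        DynamicSubmodular.localSearch_spec (μ := 1) hr hf le_rfl zero_le_one (by norm_num) ?_
          (by norm_num)⟩
      intro W hWV s hs T hT hTi
      have h1 := hs.le_of_rank_le_one hf hWV (DynamicSubmodular.card_le_of_eRank_eq hr) hT hTi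
      nlinarith [hf.nonneg T (hT.trans hWV)]
    · have hk : 2 ≤ k := by lia
      have hk' : (0 : ℝ) < k := by exact_mod_cast Nat.pos_of_ne_zero hk0
      have hδ : 0 < ε / k := by positivity
      refine ⟨DynamicSubmodular.localSearch α (ε / k) ⌈((k : ℝ) / ε) ^ 2⌉₊, fun V M f _ hr hf =>
        DynamicSubmodular.localSearch_spec (μ := ε / k) hr hf hδ.le hδ.le ?_ ?_
          (DynamicSubmodular.query_bound hε hε2.le hk)⟩
      -- With `δ = ε/k`, Bernoulli gives `(1 + δ)^N ≥ 1 + Nδ ≥ k/ε = 1/δ`, which dictates the choice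
      -- of `N`.
      · have h1 := one_add_mul_le_pow (a := ε / k) (by linarith) ⌈((k : ℝ) / ε) ^ 2⌉₊
        have h2 := Nat.le_ceil (((k : ℝ) / ε) ^ 2)
        have h3 : ((k : ℝ) / ε) ^ 2 * (ε / k) = k / ε := by field_simp
        have h4 := mul_le_mul_of_nonneg_right h2 hδ.le
        calc (1 : ℝ) = ε / k * (k / ε) := by field_simp
          _ ≤ ε / k * (1 + ε / k) ^ ⌈((k : ℝ) / ε) ^ 2⌉₊ :=
            mul_le_mul_of_nonneg_left (by linarith) hδ.le
      · intro W hWV s hs T hT hTi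
        exact hs.approx hf hWV hδ.le hε.le hε2.le (mul_div_cancel₀ ε hk'.ne').le
          (DynamicSubmodular.card_le_of_eRank_eq hr) hT hTi
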